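/- \textbf{Theorem (Impossibility of concentrated DP unbiased estimation for exponential families).} \emph{Exponential families.} Let $D\subseteq\mathbb{R}$ be measurable, and let $h\colon D\to[0,\infty)$ and $T\colon D\to\mathbb{R}$ be measurable. Put $Z(\eta)=\ln\int_D h(x)e^{\eta T(x)}\,dx$ for $\eta\in\mathbb{R}$. The exponential family with carrier $h$ and sufficient statistic $T$ consists of the probability measures $P_\eta$ on $\mathbb{R}$ with Lebesgue density $h(x)\exp(\eta T(x)-Z(\eta))$ on $D$ (and $0$ outside $D$), where $\eta$ runs through the natural parameters, i.e. the $\eta\in\mathbb{R}$ for which $Z(\eta)$ is finite. \emph{Concentrated DP.} For probability measures $\mu,\nu$ and $t>0$, let $$\mathrm{D}_{t+1}(\mu\|\nu)=\frac1t\log\mathbb{E}_{Y\leftarrow\mu}\left[\left(\frac{d\mu}{d\nu}(Y)\right)^{t}\right]$$ denote the R\'enyi divergence of order $t+1$ (which is $+\infty$ if $\mu\not\ll\nu$). A randomized algorithm $M\colon\mathcal{X}^n\to\mathcal{Y}$ (a Markov kernel) is $\rho$-zCDP if $\mathrm{D}_{t+1}(M(x)\|M(x'))\le(t+1)\rho$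 for all $t>0$ and all $x,x'\in\mathcal{X}^n$ at Hamming distance $1$. \emph{Statement.} Let $U\subseteq\mathbb{R}$ be an interval of infinite length, let $\{P_\eta:\eta\in U\}$ be an exponential family as above (all elements of $U$ being natural parameters), and let $I\subseteq U$ be an interval of positive length. Then for all real $\rho\ge0$ and integers $n\ge0$ there is no $\rho$-zCDP algorithm $M\colon\mathbb{R}^n\to\mathbb{R}$ such that, for every $\eta\in I$, $$\mathbb{E}_{X\leftarrow P_\eta^n,\,M}[M(X)]=\eta\qquad\text{and}\qquad\mathbb{E}_{X\leftarrow P_\eta^n,\,M}[M(X)^2]<\infty .$$ -/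

import Mathlib

open MeasureTheory ProbabilityTheory
open scoped ENNReal NNReal

/-- The data of a one-parameter exponential family on `ℝ`: a support `D ⊆ ℝ`, a carrier density
`h : D → [0, ∞)` and a sufficient statistic `T : D → ℝ`, all measurable. The functions are given on
all of `ℝ`, but only their values on `D` are ever used. -/
structure ExponentialFamily where
  D : Set ℝ
  h : ℝ → ℝ≥0
  T : ℝ → ℝ
  measurableSet_D : MeasurableSet D
  measurable_h : Measurable h
  measurable_T : Measurable T

namespace ExponentialFamily

/-- The partition function `exp (Z η) = ∫_D h(x) exp(η T(x)) dx`, with values in `[0, ∞]`. -/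
noncomputable def partitionFunction (F : ExponentialFamily) (η : ℝ) : ℝ≥0∞ :=
  ∫⁻ x in F.D, (F.h x : ℝ≥0∞) * ENNReal.ofReal (Real.exp (η * F.T x))

/-- The log-partition function `Z`; it is meaningful on `F.naturalParameters`. -/
noncomputable def logPartition (F : ExponentialFamily) (η : ℝ) : ℝ :=
  Real.log (F.partitionFunction η).toReal

/-- The range of natural parameters: the `η` for which `Z η` is finite. (The value `0` of the
partition function, that is `Z η = -∞`, is excluded: it occurs only if `h` vanishes almost
everywhere on `D`, in which case there is no probability measure `P_η`.) -/
def naturalParameters (F : ExponentialFamily) : Set ℝ :=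
  {η | F.partitionFunction η ≠ 0 ∧ F.partitionFunction η ≠ ∞}

/-- The density `h(x) exp(η T(x) - Z(η))`, `x ∈ D`. -/
noncomputable def density (F : ExponentialFamily) (η x : ℝ) : ℝ :=
  F.h x * Real.exp (η * F.T x - F.logPartition η)

/-- The member `P_η` of the family, a measure on `ℝ`. -/
noncomputable def P (F : ExponentialFamily) (η : ℝ) : Measure ℝ :=
  (volume.restrict F.D).withDensity fun x => ENNReal.ofReal (F.density η x)

theorem isProbabilityMeasure_P (F : ExponentialFamily) {η : ℝ} (hη : η ∈ F.naturalParameters) :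
    IsProbabilityMeasure (F.P η) := by
  obtain ⟨h0, h1⟩ := hη
  have hpos : 0 < (F.partitionFunction η).toReal := ENNReal.toReal_pos h0 h1
  have hm : Measurable fun x => (F.h x : ℝ≥0∞) * ENNReal.ofReal (Real.exp (η * F.T x)) :=
    F.measurable_h.coe_nnreal_ennreal.mul
      (Real.measurable_exp.comp (F.measurable_T.const_mul η)).ennreal_ofReal
  refine ⟨?_⟩
  have key : ∀ x, ENNReal.ofReal (F.density η x) = (F.partitionFunction η)⁻¹ *
      ((F.h x : ℝ≥0∞) * ENNReal.ofReal (Real.exp (η * F.T x))) := by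
    intro x
    have hd : F.density η x = (F.partitionFunction η).toReal⁻¹ *
        (F.h x * Real.exp (η * F.T x)) := by
      rw [density, logPartition, Real.exp_sub, Real.exp_log hpos]
      ring
    rw [hd, ENNReal.ofReal_mul (inv_nonneg.2 hpos.le), ENNReal.ofReal_mul (NNReal.coe_nonneg _),
      ENNReal.ofReal_inv_of_pos hpos, ENNReal.ofReal_toReal h1, ENNReal.ofReal_coe_nnreal]
  rw [P, withDensity_apply _ MeasurableSet.univ, Measure.restrict_univ]
  simp_rw [key]
  rw [lintegral_const_mul _ hm]
  exact ENNReal.inv_mul_cancel h0 h1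

end ExponentialFamily

open Classical in
/-- The Rényi divergence `D_α(μ ‖ ν) = (α - 1)⁻¹ log E_{Y ← μ} [(dμ/dν)(Y) ^ (α - 1)]` of order
`α > 1` between probability measures; it is `+∞` when `μ` is not absolutely continuous with
respect to `ν`. -/
noncomputable def renyiDiv {𝒴 : Type*} [MeasurableSpace 𝒴] (α : ℝ) (μ ν : Measure 𝒴) : EReal :=
  if μ ≪ ν then
    (((α - 1)⁻¹ : ℝ) : EReal) * ENNReal.log (∫⁻ y, (μ.rnDeriv ν y) ^ (α - 1) ∂μ)
  else ⊤

/-- `ρ`-zero-concentrated differential privacy of a randomized algorithm `M : 𝒳ⁿ → 𝒴`, given as the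
Markov kernel sending `x` to the law of `M(x)`. Two datasets are neighboring when their Hamming
distance is `1`. -/
def IsZCDP {𝒳 𝒴 : Type*} [DecidableEq 𝒳] [MeasurableSpace 𝒳] [MeasurableSpace 𝒴] {n : ℕ}
    (ρ : ℝ) (M : Kernel (Fin n → 𝒳) 𝒴) : Prop :=
  ∀ x x' : Fin n → 𝒳, hammingDist x x' = 1 →
    ∀ t : ℝ, 0 < t → renyiDiv (t + 1) (M x) (M x') ≤ (((t + 1) * ρ : ℝ) : EReal)

/-- The law of `M(X)`, where `X = (X₁, …, Xₙ)` consists of `n` independent samples from `P` and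
`M` uses its own independent randomness. -/
noncomputable def outputLaw {n : ℕ} (M : Kernel (Fin n → ℝ) ℝ) (P : Measure ℝ) : Measure ℝ :=
  (Measure.pi fun _ : Fin n => P).bind M

/-! Privacy forces the conditional mean g(x) = E[M(x)] to be bounded, while unbiasedness forces it
to have arbitrarily large averages. Boundedness: a finite second moment at η₀ gives one dataset x₀
where M(x₀) has a finite second moment. Hölder's inequality and the Rényi bounds carry moments from
a dataset to its neighbors at an arbitrarily small loss of order, so after n replacements the first
moment is bounded uniformly over all datasets (`IsZCDP.exists_lintegral_rpow_le`). Contradiction: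
let ν be the n-fold product of the carrier measure and S the sum of the T(xᵢ). Unbiasedness on I
reads ∫ g exp(ηS) dν = η ∫ exp(ηS) dν. Both sides are analytic in η, so the identity extends to the
interior of U, where |g| ≤ C yields |η| ≤ C (`abs_le_of_integral_mul_exp_eq`). But U has infinite
length. -/

theorem lintegral_pi_fin_prod {n : ℕ} {E : Type*} [MeasurableSpace E]
    {μ : Fin n → Measure E} [∀ i, SigmaFinite (μ i)] {f : Fin n → E → ℝ≥0∞}
    (hf : ∀ i, Measurable (f i)) :
    ∫⁻ x : Fin n → E, ∏ i, f i (x i) ∂(Measure.pi μ) = ∏ i, ∫⁻ x, f i x ∂(μ i) := by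
  induction n with
  | zero => simp
  | succ n ih =>
    rw [← ((measurePreserving_piFinSuccAbove μ 0).symm).map_eq, lintegral_map_equiv]
    simp_rw [MeasurableEquiv.piFinSuccAbove_symm_apply, Fin.insertNthEquiv,
      Fin.prod_univ_succ, Fin.insertNth_zero, Equiv.coe_fn_mk, Fin.cons_succ,
      Fin.cons_zero]
    rw [← ih fun i => hf i.succ]
    exact lintegral_prod_mul (f := f 0) (g := fun y : Fin n → E => ∏ i : Fin n, f i.succ (y i))
      (hf 0).aemeasurable (Finset.measurable_fun_prod _ fun i _ =>
        (hf i.succ).comp (measurable_pi_apply i)).aemeasurable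

theorem pi_withDensity {n : ℕ} {E : Type*} [MeasurableSpace E]
    {μ : Fin n → Measure E} [∀ i, SigmaFinite (μ i)] {f : Fin n → E → ℝ≥0∞}
    (hf : ∀ i, Measurable (f i)) [∀ i, SigmaFinite ((μ i).withDensity (f i))] :
    Measure.pi (fun i => (μ i).withDensity (f i)) =
      (Measure.pi μ).withDensity fun x => ∏ i, f i (x i) := by
  refine Measure.pi_eq fun s hs => ?_
  rw [withDensity_apply _ (MeasurableSet.univ_pi hs), Measure.restrict_pi_pi,
    lintegral_pi_fin_prod hf]
  exact Finset.prod_congr rfl fun i _ => (withDensity_apply _ (hs i)).symm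

/-! ### Transfer of moments between neighboring datasets -/

/-- Hölder with conjugate exponents t + 1 and (t + 1)/t, applied under ν to dμ/dν times f ^ q. The
(t + 1)-th moment of dμ/dν under ν is its t-th moment under μ, which is what the Rényi divergence
controls. -/
theorem lintegral_rpow_le_of_absolutelyContinuous {α : Type*} [MeasurableSpace α]
    {μ ν : Measure α} [IsFiniteMeasure μ] [IsFiniteMeasure ν] (hμν : μ ≪ ν) {f : α → ℝ≥0∞}
    (hf : Measurable f) {q t : ℝ} (ht : 0 < t) :
    ∫⁻ y, f y ^ q ∂μ ≤ (∫⁻ y, μ.rnDeriv ν y ^ t ∂μ) ^ (1 / (t + 1)) *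
      (∫⁻ y, f y ^ (q * ((t + 1) / t)) ∂ν) ^ (1 / ((t + 1) / t)) := by
  have hm := Measure.measurable_rnDeriv μ ν
  have hconj : (t + 1).HolderConjugate ((t + 1) / t) := by
    rw [Real.holderConjugate_iff]
    refine ⟨by linarith, ?_⟩
    field_simp
    ring
  have h := ENNReal.lintegral_mul_le_Lp_mul_Lq ν hconj hm.aemeasurable
    (hf.pow_const q).aemeasurable
  have h1 : ∫⁻ y, (μ.rnDeriv ν * fun y => f y ^ q) y ∂ν = ∫⁻ y, f y ^ q ∂μ :=
    lintegral_rnDeriv_mul hμν (hf.pow_const q).aemeasurable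
  have h2 : ∫⁻ y, μ.rnDeriv ν y ^ (t + 1) ∂ν = ∫⁻ y, μ.rnDeriv ν y ^ t ∂μ := by
    rw [← lintegral_rnDeriv_mul hμν (hm.pow_const t).aemeasurable]
    refine lintegral_congr fun y => ?_
    rw [add_comm, ENNReal.rpow_add_of_nonneg _ _ zero_le_one ht.le, ENNReal.rpow_one]
  rw [h1, h2] at h
  simpa only [← ENNReal.rpow_mul] using h

theorem absolutelyContinuous_and_lintegral_rnDeriv_rpow_le {𝒴 : Type*} [MeasurableSpace 𝒴]
    {μ ν : Measure 𝒴} {t r : ℝ} (ht : 0 < t) (h : renyiDiv (t + 1) μ ν ≤ (r : EReal)) :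
    μ ≪ ν ∧ ∫⁻ y, μ.rnDeriv ν y ^ t ∂μ ≤ EReal.exp ((t * r : ℝ) : EReal) := by
  unfold renyiDiv at h
  split_ifs at h with hac
  · refine ⟨hac, ?_⟩
    rw [add_sub_cancel_right] at h
    rw [← ENNReal.log_le_log_iff, EReal.log_exp, EReal.coe_mul]
    have h2 := mul_le_mul_of_nonneg_left h (a := (t : EReal)) (by exact_mod_cast ht.le)
    rwa [← mul_assoc, ← EReal.coe_mul, mul_inv_cancel₀ ht.ne', EReal.coe_one, one_mul] at h2
  · exact absurd h (by simp)

theorem hammingDist_update_self {ι X : Type*} [Fintype ι] [DecidableEq ι] [DecidableEq X]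
    (x : ι → X) {i : ι} {a : X} (h : a ≠ x i) : hammingDist (Function.update x i a) x = 1 := by
  rw [hammingDist, Finset.card_eq_one]
  refine ⟨i, Finset.ext fun j => ?_⟩
  by_cases hj : j = i
  · subst hj; simpa using h
  · simp [hj]

theorem lintegral_rpow_le_one_add {α : Type*} [MeasurableSpace α] (μ : Measure α)
    [IsProbabilityMeasure μ] (f : α → ℝ≥0∞) {q p : ℝ} (hq : 0 ≤ q) (hqp : q ≤ p) :
    ∫⁻ y, f y ^ q ∂μ ≤ 1 + ∫⁻ y, f y ^ p ∂μ := by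
  calc ∫⁻ y, f y ^ q ∂μ ≤ ∫⁻ y, (1 + f y ^ p) ∂μ := by
        refine lintegral_mono fun y => ?_
        rcases le_total (f y) 1 with h | h
        · exact (ENNReal.rpow_le_one h hq).trans le_self_add
        · exact (ENNReal.rpow_le_rpow_of_exponent_le h hqp).trans le_add_self
    _ = 1 + ∫⁻ y, f y ^ p ∂μ := by
        rw [lintegral_add_left measurable_const]; simp

namespace IsZCDP

variable {𝒳 𝒴 : Type*} [DecidableEq 𝒳] [MeasurableSpace 𝒳] [MeasurableSpace 𝒴] {n : ℕ} {ρ : ℝ}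
  {M : Kernel (Fin n → 𝒳) 𝒴} [IsMarkovKernel M]

/-- If `f` has a finite `p`-th moment under the output on one dataset, then its moments of lower
order are bounded uniformly over all datasets. -/
theorem exists_lintegral_rpow_piecewise_le (hM : IsZCDP ρ M) {f : 𝒴 → ℝ≥0∞} (hf : Measurable f)
    {p : ℝ} {x₀ : Fin n → 𝒳} (hx₀ : ∫⁻ y, f y ^ p ∂(M x₀) ≠ ∞) (s : Finset (Fin n)) :
    ∀ q : ℝ, 0 < q → q < p →
      ∃ C : ℝ≥0∞, C ≠ ∞ ∧ ∀ x, ∫⁻ y, f y ^ q ∂(M (s.piecewise x x₀)) ≤ C := by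
  induction s using Finset.induction_on with
  | empty =>
    intro q hq hqp
    refine ⟨1 + ∫⁻ y, f y ^ p ∂(M x₀), by simp [hx₀], fun x => ?_⟩
    rw [Finset.piecewise_empty]
    exact lintegral_rpow_le_one_add _ f hq.le hqp.le
  | insert i s _ ih =>
    intro q hq hqp
    -- Each replaced coordinate costs some moment order; the induction hypothesis covers every order
    -- below p, so an intermediate r is available.
    obtain ⟨r, hqr, hrp⟩ := exists_between hqp
    obtain ⟨C, hC, hCx⟩ := ih r (hq.trans hqr) hrp
    -- t = q / (r - q) solves q (t + 1) / t = r, so Hölder calls for exactly the r-th moment.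
    have ht : 0 < q / (r - q) := div_pos hq (sub_pos.2 hqr)
    have htr : q * ((q / (r - q) + 1) / (q / (r - q))) = r := by
      have : r - q ≠ 0 := (sub_pos.2 hqr).ne'
      field_simp
      ring
    set t := q / (r - q)
    set A : ℝ≥0∞ := EReal.exp ((t * ((t + 1) * ρ) : ℝ) : EReal)
    have hA : A ≠ ∞ := by simp [A]
    -- The first summand serves when the coordinate is unchanged, where privacy says nothing; the
    -- second is the Hölder bound at Hamming distance 1.
    refine ⟨(1 + C) + A ^ (1 / (t + 1)) * C ^ (1 / ((t + 1) / t)), ?_, fun x => ?_⟩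
    · refine ENNReal.add_ne_top.2 ⟨by simp [hC], ENNReal.mul_ne_top ?_ ?_⟩
      · exact ENNReal.rpow_ne_top_of_nonneg (by positivity) hA
      · exact ENNReal.rpow_ne_top_of_nonneg (by positivity) hC
    · rw [Finset.piecewise_insert]
      by_cases h : x i = s.piecewise x x₀ i
      · rw [h, Function.update_eq_self]
        exact ((lintegral_rpow_le_one_add _ f hq.le hqr.le).trans
          (add_le_add le_rfl (hCx x))).trans le_self_add
      · obtain ⟨hac, hle⟩ := absolutelyContinuous_and_lintegral_rnDeriv_rpow_le ht
          (hM _ _ (hammingDist_update_self _ h) t ht)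
        refine (lintegral_rpow_le_of_absolutelyContinuous hac hf ht).trans ?_
        rw [htr]
        refine le_trans ?_ le_add_self
        gcongr
        exact hCx x

theorem exists_lintegral_rpow_le (hM : IsZCDP ρ M) {f : 𝒴 → ℝ≥0∞} (hf : Measurable f)
    {p : ℝ} {x₀ : Fin n → 𝒳} (hx₀ : ∫⁻ y, f y ^ p ∂(M x₀) ≠ ∞) {q : ℝ} (hq : 0 < q)
    (hqp : q < p) : ∃ C : ℝ≥0∞, C ≠ ∞ ∧ ∀ x, ∫⁻ y, f y ^ q ∂(M x) ≤ C := by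
  simpa using hM.exists_lintegral_rpow_piecewise_le hf hx₀ Finset.univ q hq hqp

end IsZCDP

section Analytic

variable {Ω : Type*} [MeasurableSpace Ω] {ν : Measure Ω} {S g : Ω → ℝ} {K : ℝ}

/-- Shifting g by K makes it a nonnegative density, so the signed integral becomes a combination of
moment generating functions and inherits their analyticity. -/
theorem integral_mul_exp_eq_mgf_sub (hg : Measurable g) (hgK : ∀ x, |g x| ≤ K) {t : ℝ}
    (ht : t ∈ integrableExpSet S ν) :
    t ∈ integrableExpSet S (ν.withDensity fun x => ENNReal.ofReal (g x + K)) ∧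
    ∫ x, g x * Real.exp (t * S x) ∂ν =
      mgf S (ν.withDensity fun x => ENNReal.ofReal (g x + K)) t - K * mgf S ν t := by
  have ht' : Integrable (fun x => Real.exp (t * S x)) ν := ht
  have hm : Measurable fun x => (g x + K).toNNReal := (hg.add_const K).real_toNNReal
  have hnn : ∀ x, 0 ≤ g x + K := fun x => by linarith [neg_le_of_abs_le (hgK x)]
  have hint : Integrable (fun x => g x * Real.exp (t * S x)) ν :=
    ht'.bdd_mul (c := K) hg.aestronglyMeasurable (Filter.Eventually.of_forall fun x => hgK x)
  have hsm : (fun x => (g x + K).toNNReal • Real.exp (t * S x)) =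
      fun x => g x * Real.exp (t * S x) + K * Real.exp (t * S x) := by
    funext x
    rw [NNReal.smul_def, Real.coe_toNNReal _ (hnn x), smul_eq_mul, add_mul]
  constructor
  · change Integrable _ _
    refine (integrable_withDensity_iff_integrable_smul hm).2 ?_
    rw [hsm]
    exact hint.add (ht'.const_mul K)
  · have : mgf S (ν.withDensity fun x => ENNReal.ofReal (g x + K)) t =
        ∫ x, (g x + K).toNNReal • Real.exp (t * S x) ∂ν :=
      integral_withDensity_eq_integral_smul hm _
    rw [this, hsm, integral_add hint (ht'.const_mul K), integral_const_mul, mgf]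
    ring

theorem analyticOnNhd_integral_mul_exp (hg : Measurable g) (hgK : ∀ x, |g x| ≤ K) :
    AnalyticOnNhd ℝ (fun t => ∫ x, g x * Real.exp (t * S x) ∂ν)
      (interior (integrableExpSet S ν)) := by
  have hsub : integrableExpSet S ν ⊆
      integrableExpSet S (ν.withDensity fun x => ENNReal.ofReal (g x + K)) :=
    fun t ht => (integral_mul_exp_eq_mgf_sub hg hgK ht).1
  have h : AnalyticOnNhd ℝ (fun t => mgf S (ν.withDensity fun x => ENNReal.ofReal (g x + K)) t -
      K * mgf S ν t) (interior (integrableExpSet S ν)) :=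
    (analyticOnNhd_mgf.mono (interior_mono hsub)).sub
      (analyticOnNhd_const.mul analyticOnNhd_mgf)
  exact h.congr isOpen_interior fun t ht =>
    (integral_mul_exp_eq_mgf_sub hg hgK (interior_subset ht)).2.symm

/-- A bounded statistic cannot have exponentially tilted mean `t` at large parameters `t`, once
this holds on an open set of parameters. -/
theorem abs_le_of_integral_mul_exp_eq [NeZero ν] (hg : Measurable g) (hgK : ∀ x, |g x| ≤ K)
    {V W : Set ℝ} (hV : IsPreconnected V) (hVS : V ⊆ interior (integrableExpSet S ν))
    (hW : IsOpen W) (hWne : W.Nonempty) (hWV : W ⊆ V)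
    (heq : ∀ t ∈ W, ∫ x, g x * Real.exp (t * S x) ∂ν = t * mgf S ν t) :
    ∀ t ∈ V, |t| ≤ K := by
  intro t ht
  obtain ⟨w, hw⟩ := hWne
  have h := ((analyticOnNhd_integral_mul_exp (S := S) (ν := ν) hg hgK).mono
    hVS).eqOn_of_preconnected_of_eventuallyEq
    (g := fun t => t * mgf S ν t) (analyticOnNhd_id.mul (analyticOnNhd_mgf.mono hVS)) hV (hWV hw)
    (Filter.eventuallyEq_of_mem (hW.mem_nhds hw) heq) ht
  have hint : Integrable (fun x => Real.exp (t * S x)) ν :=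
    interior_subset (s := integrableExpSet S ν) (hVS ht)
  have hpos : 0 < mgf S ν t := mgf_pos' (NeZero.ne ν) hint
  have hle : |∫ x, g x * Real.exp (t * S x) ∂ν| ≤ K * mgf S ν t := by
    rw [mgf, ← integral_const_mul, ← Real.norm_eq_abs]
    refine norm_integral_le_of_norm_le (hint.const_mul K) (Filter.Eventually.of_forall fun x => ?_)
    rw [norm_mul, Real.norm_eq_abs, Real.norm_of_nonneg (Real.exp_pos _).le]
    exact mul_le_mul_of_nonneg_right (hgK x) (Real.exp_pos _).le
  simp only at h
  rw [h, abs_mul, abs_of_pos hpos] at hle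
  exact le_of_mul_le_mul_right hle hpos

end Analytic

/-! ### Samples from the family as exponential tilts of one product measure -/

namespace ExponentialFamily

variable (F : ExponentialFamily)

/-- The measure on `ℝ` with Lebesgue density `h` on `D`. -/
noncomputable def carrierMeasure : Measure ℝ :=
  (volume.restrict F.D).withDensity fun x => (F.h x : ℝ≥0∞)

instance : SigmaFinite F.carrierMeasure :=
  SigmaFinite.withDensity F.h

theorem P_eq_withDensity_carrierMeasure (η : ℝ) : F.P η = F.carrierMeasure.withDensity
    fun x => ENNReal.ofReal (Real.exp (η * F.T x - F.logPartition η)) := by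
  have hm : Measurable fun x => ENNReal.ofReal (Real.exp (η * F.T x - F.logPartition η)) :=
    (((F.measurable_T.const_mul η).sub_const _).exp).ennreal_ofReal
  rw [carrierMeasure, ← withDensity_mul _ F.measurable_h.coe_nnreal_ennreal hm, P]
  congr 1
  funext x
  simp [density, ENNReal.ofReal_mul]

/-- The sufficient statistic of a sample of size `n`. -/
noncomputable def sampleStatistic (n : ℕ) (x : Fin n → ℝ) : ℝ := ∑ i, F.T (x i)

theorem measurable_sampleStatistic (n : ℕ) : Measurable (F.sampleStatistic n) :=
  Finset.measurable_sum _ fun i _ => F.measurable_T.comp (measurable_pi_apply i)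

theorem pi_P_eq_withDensity (n : ℕ) {η : ℝ} (hη : η ∈ F.naturalParameters) :
    Measure.pi (fun _ : Fin n => F.P η) =
      (Measure.pi fun _ : Fin n => F.carrierMeasure).withDensity fun x =>
        ENNReal.ofReal (Real.exp (η * F.sampleStatistic n x - n * F.logPartition η)) := by
  have := F.isProbabilityMeasure_P hη
  have hm : Measurable fun x => ENNReal.ofReal (Real.exp (η * F.T x - F.logPartition η)) :=
    (((F.measurable_T.const_mul η).sub_const _).exp).ennreal_ofReal
  rw [P_eq_withDensity_carrierMeasure] at this ⊢
  rw [pi_withDensity fun _ => hm]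
  congr 1
  funext x
  rw [← ENNReal.ofReal_prod_of_nonneg fun i _ => (Real.exp_pos _).le, ← Real.exp_sum]
  simp [sampleStatistic, Finset.sum_sub_distrib, Finset.mul_sum]

theorem integral_pi_P (n : ℕ) {η : ℝ} (hη : η ∈ F.naturalParameters) (g : (Fin n → ℝ) → ℝ) :
    ∫ x, g x ∂(Measure.pi fun _ : Fin n => F.P η) =
      Real.exp (-(n * F.logPartition η)) * ∫ x, g x * Real.exp (η * F.sampleStatistic n x)
        ∂(Measure.pi fun _ : Fin n => F.carrierMeasure) := by
  have hm : Measurable fun x =>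
      (Real.exp (η * F.sampleStatistic n x - n * F.logPartition η)).toNNReal :=
    ((((F.measurable_sampleStatistic n).const_mul η).sub_const _).exp).real_toNNReal
  rw [F.pi_P_eq_withDensity n hη, ← integral_const_mul]
  refine (integral_withDensity_eq_integral_smul hm g).trans (integral_congr_ae (.of_forall ?_))
  intro x
  beta_reduce
  rw [NNReal.smul_def, Real.coe_toNNReal _ (Real.exp_pos _).le, smul_eq_mul, sub_eq_add_neg,
    Real.exp_add]
  ring

theorem naturalParameters_subset_integrableExpSet (n : ℕ) : F.naturalParameters ⊆
    integrableExpSet (F.sampleStatistic n) (Measure.pi fun _ : Fin n => F.carrierMeasure) := by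
  intro η hη
  have := F.isProbabilityMeasure_P hη
  have h : Integrable (fun _ => (1 : ℝ)) (Measure.pi fun _ : Fin n => F.P η) :=
    integrable_const 1
  have hm : Measurable fun x =>
      (Real.exp (η * F.sampleStatistic n x - n * F.logPartition η)).toNNReal :=
    ((((F.measurable_sampleStatistic n).const_mul η).sub_const _).exp).real_toNNReal
  rw [F.pi_P_eq_withDensity n hη] at h
  have h2 := ((integrable_withDensity_iff_integrable_smul hm).1 h).const_mul
    (Real.exp (n * F.logPartition η))
  refine h2.congr (.of_forall fun x => ?_)
  simp only [NNReal.smul_def, Real.coe_toNNReal _ (Real.exp_pos _).le, smul_eq_mul, mul_one]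
  rw [← Real.exp_add]
  congr 1
  ring

end ExponentialFamily

/-- A convex set has null frontier. Analyticity is available only on open sets, so I and U are
replaced by their interiors. -/
theorem volume_interior_of_ordConnected {s : Set ℝ} (hs : s.OrdConnected) :
    volume (interior s) = volume s := by
  refine le_antisymm (measure_mono interior_subset) ?_
  have hsub : s ⊆ interior s ∪ frontier s := by
    rw [← closure_eq_interior_union_frontier]
    exact subset_closure
  refine (measure_mono hsub).trans ((measure_union_le _ _).trans ?_)
  rw [hs.convex.addHaar_frontier volume, add_zero]

/-! ### The impossibility theorem -/

theorem mainTheorem9 (F : ExponentialFamily)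
    (U : Set ℝ) (hU : U.OrdConnected) (hUinf : volume U = ∞) (hUF : U ⊆ F.naturalParameters)
    (I : Set ℝ) (hI : I.OrdConnected) (hIpos : 0 < volume I) (hIU : I ⊆ U)
    (ρ : ℝ) (hρ : 0 ≤ ρ) (n : ℕ) :
    ¬ ∃ M : Kernel (Fin n → ℝ) ℝ, IsMarkovKernel M ∧ IsZCDP ρ M ∧
      ∀ η ∈ I, ∫ y, y ∂(outputLaw M (F.P η)) = η ∧
        ∫⁻ y, ENNReal.ofReal (y ^ 2) ∂(outputLaw M (F.P η)) < ∞ := by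
  rintro ⟨M, hMk, hM, hest⟩
  obtain ⟨η₀, hη₀⟩ : (interior I).Nonempty := by
    rw [Set.nonempty_iff_ne_empty]
    intro h
    rw [← volume_interior_of_ordConnected hI, h, measure_empty] at hIpos
    exact hIpos.false
  have hη₀U := hUF (hIU (interior_subset hη₀))
  have hP₀ := F.isProbabilityMeasure_P hη₀U
  obtain ⟨x₀, hx₀⟩ : ∃ x₀, ∫⁻ y, ‖y‖ₑ ^ (2 : ℝ) ∂(M x₀) ≠ ∞ := by
    have h := (hest η₀ (interior_subset hη₀)).2
    have hsq : Measurable fun y : ℝ => ENNReal.ofReal (y ^ 2) := by fun_prop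
    rw [outputLaw, Measure.lintegral_bind M.aemeasurable hsq.aemeasurable] at h
    -- A finite average of second moments is finite almost everywhere, and one dataset suffices.
    obtain ⟨x₀, hx₀⟩ := (ae_lt_top hsq.lintegral_kernel h.ne).exists
    refine ⟨x₀, ?_⟩
    convert hx₀.ne using 4 with y
    rw [← sq_abs, ENNReal.ofReal_pow (abs_nonneg y), Real.enorm_eq_ofReal_abs,
      ENNReal.rpow_two]
  -- The gap between orders 1 and 2 absorbs the loss over all n replacements.
  obtain ⟨C, hC, hCx⟩ := hM.exists_lintegral_rpow_le measurable_enorm hx₀ one_pos one_lt_two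
  simp only [ENNReal.rpow_one] at hCx
  set g : (Fin n → ℝ) → ℝ := fun x => ∫ y, y ∂(M x) with hg
  have hgm : Measurable g := (stronglyMeasurable_id.integral_kernel (κ := M)).measurable
  have hgC : ∀ x, |g x| ≤ C.toReal := fun x => by
    rw [← Real.norm_eq_abs, ← toReal_enorm]
    exact ENNReal.toReal_mono hC ((enorm_integral_le_lintegral_enorm _).trans (hCx x))
  have hmean : ∀ η ∈ I, ∫ x, g x ∂(Measure.pi fun _ : Fin n => F.P η) = η := by
    intro η hη
    have := F.isProbabilityMeasure_P (hUF (hIU hη))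
    have hint : Integrable (fun y : ℝ => y) (outputLaw M (F.P η)) := by
      refine ⟨measurable_id.aestronglyMeasurable, ?_⟩
      rw [HasFiniteIntegral, outputLaw,
        Measure.lintegral_bind M.aemeasurable measurable_enorm.aemeasurable]
      refine (lintegral_mono hCx).trans_lt ?_
      simpa using hC.lt_top
    refine Eq.trans ?_ (hest η hη).1
    rw [outputLaw, Measure.comp_eq_comp_const_apply] at *
    rw [Kernel.integral_comp hint, Kernel.const_apply]
  have : NeZero (Measure.pi fun _ : Fin n => F.carrierMeasure) := by
    refine ⟨fun h => ?_⟩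
    have h1 := F.pi_P_eq_withDensity n hη₀U
    rw [h, withDensity_zero_left] at h1
    exact IsProbabilityMeasure.ne_zero _ h1
  have hUC : ∀ η ∈ interior U, |η| ≤ C.toReal := by
    refine abs_le_of_integral_mul_exp_eq (S := F.sampleStatistic n) hgm hgC
      hU.interior.isPreconnected
      (interior_mono (hUF.trans (F.naturalParameters_subset_integrableExpSet n)))
      isOpen_interior ⟨η₀, hη₀⟩ (interior_mono hIU) fun η hη => ?_
    have hηI := interior_subset hη
    have hηF := hUF (hIU hηI)
    have := F.isProbabilityMeasure_P hηF
    have h1 := F.integral_pi_P n hηF g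
    have h2 := F.integral_pi_P n hηF fun _ => 1
    rw [hmean η hηI] at h1
    simp only [one_mul, integral_const, probReal_univ, smul_eq_mul, mul_one] at h2
    -- After multiplying by the normalizing factor, the left side is the mean η (`h1`) and the right
    -- side is η times the total mass 1 (`h2`).
    rw [← mul_right_inj' (Real.exp_pos (-(n * F.logPartition η))).ne', ← h1, mgf,
      mul_left_comm, ← h2, mul_one]
  have hvol : volume (interior U) ≤ volume (Set.Icc (-C.toReal) C.toReal) :=
    measure_mono fun η hη => abs_le.1 (hUC η hη)
  rw [volume_interior_of_ordConnected hU, hUinf, Real.volume_Icc] at hvol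
  exact ENNReal.ofReal_ne_top (top_le_iff.1 hvol)
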